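/- Let $(\rho_{ij})_{i\ne j}$, $i,j\in\{1,2,\dots\}$, be real numbers such that for every $n$ the $n\times n$ matrix $\mathbf\Sigma_n$ with diagonal entries $1$ and off-diagonal entries $\rho_{ij}$ is a correlation matrix (that is, symmetric and positive semidefinite). For $\alpha\in(0,1)$ let $$FWER(n,\alpha,\mathbf\Sigma_n)=\mathbb P\Big(X_i>\Phi^{-1}(1-\alpha/n)\ \text{for some } 1\le i\le n\Big),\qquad (X_1,\dots,X_n)\sim N(\mathbf 0,\mathbf\Sigma_n),$$ be the familywise error rate, under the global null hypothesis that all means are $0$, of the one-sided Bonferroni procedure at level $\alpha$, where $\Phi$ is the standard normal distribution function. Suppose that $$\liminf_{\substack{i,j\to\infty\\ i\neq j}}\rho_{ij}=\delta>0,$$ where the lower limit is taken as both indices tend to infinity. Then for every $\alpha\in(0,1)$, $$\lim_{n\to\infty}FWER(n,\alpha,\mathbf\Sigma_n)=0.$$ -/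

import Mathlib

open Filter Topology MeasureTheory ProbabilityTheory

noncomputable section

/-- The cumulative distribution function `Φ` of the standard normal distribution. -/
def stdNormalCDF (x : ℝ) : ℝ := cdf (gaussianReal 0 1) x

/-- The standard normal quantile function `Φ⁻¹`. For `0 < p < 1` it is the unique real `x`
with `Φ x = p`; values of `p` outside `(0, 1)` are not used. -/
def stdNormalQuantile (p : ℝ) : ℝ := sInf {x : ℝ | p ≤ stdNormalCDF x}

/-- The one-sided Bonferroni cutoff `c_{α,n} = Φ⁻¹(1 - α / n)`. -/
def bonferroniCutoff (α : ℝ) (n : ℕ) : ℝ := stdNormalQuantile (1 - α / n)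

/-- The matrix `Σ_n` with unit diagonal and off-diagonal entries `ρ i j`; only the values
`ρ i j` with `i ≠ j` matter. The statistics are indexed from `0`. -/
def corrMatrix (ρ : ℕ → ℕ → ℝ) (n : ℕ) : Matrix (Fin n) (Fin n) ℝ :=
  Matrix.of fun i j => if i = j then 1 else ρ i j

/-- `FWER(n, α, S)`: the probability, under the global null (all means zero, unit variances,
correlation matrix `S`, jointly Gaussian statistics), that the one-sided Bonferroni procedure
rejects at least one of the `n` hypotheses. -/
def bonferroniFWER (n : ℕ) (α : ℝ) (S : Matrix (Fin n) (Fin n) ℝ) : ℝ :=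
  (multivariateGaussian 0 S).real {x | ∃ i : Fin n, bonferroniCutoff α n < x i}

/-- The pairs `(i, j)` with `i ≠ j`, as both `i` and `j` tend to infinity. -/
def offDiagAtTop : Filter (ℕ × ℕ) := atTop ⊓ 𝓟 {p | p.1 ≠ p.2}

end

/-!
The idea is to compare each `X i` with the average of the variables. Let `0 < r < 1` be such that
`ρ i j ≥ r` for distinct `i, j ≥ N`, and let `U` be the average of `X i` over `N ≤ i < n`. Then
`Var U ≤ 1` and `Cov (X i, U) ≥ r`, so that `X i - r U` has variance at most
`1 - 2 r ^ 2 + r ^ 2 = 1 - r ^ 2 < 1`. An exceedance `X i > c` therefore requires either `U > K` or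
`X i - r U > c - r K`, and a union bound with Gaussian tails gives
`exp (-K ^ 2 / 2) + n * exp (-(c - r K) ^ 2 / (2 (1 - r ^ 2)))`
(`multivariateGaussian_real_exists_mem_gt_le`). No comparison inequality such as Slepian's lemma is
needed.

The Bonferroni cutoff `c` tends to infinity with `n`, while `n` is at most of order
`exp ((c + 2) ^ 2 / 2)` (`tendsto_bonferroniCutoff`, `natCast_le_exp_bonferroniCutoff`). With
`K = r c / 2` the second exponent is `-β c ^ 2 / 2` for some `β > 1`, which beats the growth of `n`;
the first term tends to zero as well, and so does the union bound over the `N` remaining variables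
(`bonferroniFWER_le`).
-/

open scoped RealInnerProductSpace Matrix

/-! ### Gaussian tail bounds -/

section LinearFunctional

variable {ι : Type*} [Fintype ι] [DecidableEq ι] {S : Matrix ι ι ℝ}

lemma map_inner_multivariateGaussian (hS : S.PosSemidef) (w : EuclideanSpace ℝ ι) :
    (multivariateGaussian 0 S).map (fun x => ⟪w, x⟫) =
      gaussianReal 0 (w ⬝ᵥ S *ᵥ w).toNNReal := by
  have h := IsGaussian.map_eq_gaussianReal (μ := multivariateGaussian 0 S) (innerSL ℝ w)
  have hmean : ∫ x, innerSL ℝ w x ∂(multivariateGaussian 0 S) = 0 := by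
    rw [ContinuousLinearMap.integral_comp_id_comm IsGaussian.integrable_id]
    simp
  have hvar : Var[innerSL ℝ w; multivariateGaussian 0 S] = w ⬝ᵥ S *ᵥ w := by
    rw [← covarianceBilin_multivariateGaussian (μ := 0) hS,
      covarianceBilin_self IsGaussian.memLp_two_id]
    rfl
  rw [hmean, hvar] at h
  exact h

/-- Chernoff bound for a linear functional. The variance is only required to be at most `v`; for
`v = 0` the right-hand side is `exp 0 = 1`. -/
lemma multivariateGaussian_real_inner_ge_le (hS : S.PosSemidef) (w : EuclideanSpace ℝ ι)
    {v t : ℝ} (hv : w ⬝ᵥ S *ᵥ w ≤ v) (hv0 : 0 ≤ v) (ht : 0 ≤ t) :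
    (multivariateGaussian 0 S).real {x | t ≤ ⟪w, x⟫} ≤ Real.exp (-t ^ 2 / (2 * v)) := by
  have hmap := map_inner_multivariateGaussian hS w
  have hsub : HasSubgaussianMGF (fun x => ⟪w, x⟫) v.toNNReal (multivariateGaussian 0 S) := by
    refine (HasSubgaussianMGF.id_map_iff (by fun_prop)).1 ?_
    rw [hmap]
    refine ⟨fun s => integrable_exp_mul_gaussianReal s, fun s => ?_⟩
    rw [mgf_id_gaussianReal]
    simp only [zero_mul, zero_add]
    gcongr
  simpa [Real.coe_toNNReal v hv0] using hsub.measure_ge_le ht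

lemma multivariateGaussian_real_coord_gt_le (hS : S.PosSemidef) (i : ι) (hi : S i i = 1)
    {t : ℝ} (ht : 0 ≤ t) :
    (multivariateGaussian 0 S).real {x | t < x i} ≤ Real.exp (-t ^ 2 / 2) := by
  have h := multivariateGaussian_real_inner_ge_le hS (EuclideanSpace.single i 1) (v := 1) (t := t)
    (by simp [hi]) zero_le_one ht
  rw [mul_one] at h
  refine (measureReal_mono fun x hx => ?_).trans h
  simpa [EuclideanSpace.inner_single_left] using le_of_lt hx

end LinearFunctional

/-- The crude bound `P(N > x) ≥ φ(x + 1)` for `x ≥ 0`, where `φ` is the standard normal density: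
integrate `φ` over `(x, x + 1]`. -/
lemma exp_le_one_sub_stdNormalCDF {x : ℝ} (hx : 0 ≤ x) :
    (√(2 * Real.pi))⁻¹ * Real.exp (-(x + 1) ^ 2 / 2) ≤ 1 - stdNormalCDF x := by
  have hcompl : 1 - stdNormalCDF x = (gaussianReal 0 1).real (Set.Ioi x) := by
    rw [stdNormalCDF, cdf_eq_real, ← probReal_compl_eq_one_sub measurableSet_Iic, Set.compl_Iic]
  rw [hcompl]
  calc (√(2 * Real.pi))⁻¹ * Real.exp (-(x + 1) ^ 2 / 2)
      = ∫ _ in Set.Ioc x (x + 1), (√(2 * Real.pi))⁻¹ * Real.exp (-(x + 1) ^ 2 / 2) := by simp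
    _ ≤ ∫ y in Set.Ioc x (x + 1), gaussianPDFReal 0 1 y := by
        refine setIntegral_mono_on (integrableOn_const (by simp)) (integrable_gaussianPDFReal 0 1).integrableOn
          measurableSet_Ioc fun y hy => ?_
        simp only [gaussianPDFReal, NNReal.coe_one, mul_one, sub_zero]
        have : y ^ 2 ≤ (x + 1) ^ 2 := pow_le_pow_left₀ (hx.trans hy.1.le) hy.2 2
        gcongr
    _ = (gaussianReal 0 1).real (Set.Ioc x (x + 1)) := by
        rw [measureReal_def, gaussianReal_apply_eq_integral _ one_ne_zero,
          ENNReal.toReal_ofReal (integral_nonneg fun y => gaussianPDFReal_nonneg 0 1 y)]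
    _ ≤ (gaussianReal 0 1).real (Set.Ioi x) := measureReal_mono Set.Ioc_subset_Ioi_self

/-! ### The maximum of positively correlated Gaussian variables -/

section Maximum

variable {ι : Type*} [Fintype ι] [DecidableEq ι] {S : Matrix ι ι ℝ}

lemma Matrix.PosSemidef.abs_apply_le_one (hS : S.PosSemidef) (hdiag : ∀ i, S i i = 1) (i j : ι) :
    |S i j| ≤ 1 := by
  have hsymm : S j i = S i j := by simpa using hS.isHermitian.apply i j
  have h1 := hS.dotProduct_mulVec_nonneg (Pi.single i 1 - Pi.single j 1)
  have h2 := hS.dotProduct_mulVec_nonneg (Pi.single i 1 + Pi.single j 1)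
  simp [Matrix.mulVec_sub, Matrix.mulVec_add, sub_dotProduct, add_dotProduct, hdiag,
    hsymm] at h1 h2
  rw [abs_le]
  constructor <;> linarith

/-- If the unit-variance coordinates in `T` have pairwise correlations at least `r`, then all of
them are correlated with their average `U`. On `{U ≤ K}` an exceedance `x i > c` forces
`x i - r * U > c - r * K`, and this variable has variance at most `1 - r ^ 2`. -/
lemma multivariateGaussian_real_exists_mem_gt_le (hS : S.PosSemidef) (hdiag : ∀ i, S i i = 1)
    (T : Finset ι) {r c K : ℝ} (hr0 : 0 ≤ r) (hr1 : r < 1)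
    (hT : ∀ i ∈ T, ∀ j ∈ T, r ≤ S i j) (hK : 0 ≤ K) (hc : r * K ≤ c) :
    (multivariateGaussian 0 S).real {x | ∃ i ∈ T, c < x i} ≤
      Real.exp (-K ^ 2 / 2) + T.card * Real.exp (-(c - r * K) ^ 2 / (2 * (1 - r ^ 2))) := by
  rcases T.eq_empty_or_nonempty with rfl | hne
  · simp [Real.exp_nonneg]
  set μ := multivariateGaussian 0 S
  have hm : (0 : ℝ) < T.card := by exact_mod_cast hne.card_pos
  let e : ι → EuclideanSpace ℝ ι := fun i => EuclideanSpace.single i 1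
  let u : EuclideanSpace ℝ ι := (T.card : ℝ)⁻¹ • ∑ j ∈ T, e j
  have hB (v w : EuclideanSpace ℝ ι) : covarianceBilin μ v w = v ⬝ᵥ S *ᵥ w :=
    covarianceBilin_multivariateGaussian hS v w
  have hee (i j : ι) : covarianceBilin μ (e i) (e j) = S i j := by simp [hB, e]
  have heu (i : ι) : covarianceBilin μ (e i) u = (T.card : ℝ)⁻¹ * ∑ j ∈ T, S i j := by
    simp [u, hee]
  have huu : covarianceBilin μ u u ≤ 1 := by
    have : covarianceBilin μ u u = (T.card : ℝ)⁻¹ * ∑ i ∈ T, (T.card : ℝ)⁻¹ * ∑ j ∈ T, S i j := by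
      conv_lhs => enter [1]; simp only [u]
      simp only [map_smul, map_sum, smul_apply, sum_apply,
        heu, smul_eq_mul]
    rw [this, inv_mul_le_one₀ hm]
    refine (Finset.sum_le_card_nsmul T _ 1 fun i _ => ?_).trans_eq (by simp)
    rw [inv_mul_le_one₀ hm]
    exact (Finset.sum_le_card_nsmul T _ 1 fun j _ =>
      (abs_le.1 (hS.abs_apply_le_one hdiag i j)).2).trans_eq (by simp)
  have hru {i : ι} (hi : i ∈ T) : r ≤ covarianceBilin μ (e i) u := by
    rw [heu, le_inv_mul_iff₀ hm]
    exact (by simp : (T.card : ℝ) * r = T.card • r).trans_le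
      (Finset.card_nsmul_le_sum T _ r fun j hj => hT i hi j hj)
  have hvar {i : ι} (hi : i ∈ T) :
      (e i - r • u).ofLp ⬝ᵥ S *ᵥ (e i - r • u).ofLp ≤ 1 - r ^ 2 := by
    have hexp : covarianceBilin μ (e i - r • u) (e i - r • u) =
        1 - 2 * r * covarianceBilin μ (e i) u + r ^ 2 * covarianceBilin μ u u := by
      have hcomm : covarianceBilin μ u (e i) = covarianceBilin μ (e i) u := covarianceBilin_comm ..
      simp only [map_sub, map_smul, sub_apply, smul_apply,
        hee, hdiag, hcomm, smul_eq_mul]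
      ring
    rw [← hB, hexp]
    nlinarith [mul_le_mul_of_nonneg_left (hru hi) hr0, mul_le_mul_of_nonneg_left huu (sq_nonneg r)]
  have hr2 : 0 ≤ 1 - r ^ 2 := by nlinarith
  have hsub : {x : EuclideanSpace ℝ ι | ∃ i ∈ T, c < x i} ⊆
      {x | K ≤ ⟪u, x⟫} ∪ ⋃ i ∈ T, {x | c - r * K ≤ ⟪e i - r • u, x⟫} := by
    rintro x ⟨i, hi, hx⟩
    rcases le_total K ⟪u, x⟫ with h | h
    · exact Or.inl h
    · refine Or.inr (Set.mem_iUnion₂.2 ⟨i, hi, ?_⟩)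
      have hex : ⟪e i, x⟫ = x i := by simp [e, EuclideanSpace.inner_single_left]
      simp only [Set.mem_ofPred_eq, inner_sub_left, real_inner_smul_left, hex]
      nlinarith [mul_le_mul_of_nonneg_left h hr0]
  calc μ.real {x | ∃ i ∈ T, c < x i}
      ≤ μ.real {x | K ≤ ⟪u, x⟫} + μ.real (⋃ i ∈ T, {x | c - r * K ≤ ⟪e i - r • u, x⟫}) :=
        (measureReal_mono hsub).trans (measureReal_union_le _ _)
    _ ≤ Real.exp (-K ^ 2 / 2) + ∑ i ∈ T, μ.real {x | c - r * K ≤ ⟪e i - r • u, x⟫} := by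
        refine add_le_add ?_ (measureReal_biUnion_finset_le _ _)
        have h := multivariateGaussian_real_inner_ge_le hS u (v := 1) ((hB u u).symm.trans_le huu)
          zero_le_one hK
        rwa [mul_one] at h
    _ ≤ Real.exp (-K ^ 2 / 2) + ∑ i ∈ T, Real.exp (-(c - r * K) ^ 2 / (2 * (1 - r ^ 2))) := by
        gcongr with i hi
        exact multivariateGaussian_real_inner_ge_le hS _ (hvar hi) hr2 (sub_nonneg.2 hc)
    _ = _ := by simp

end Maximum

/-! ### The Bonferroni cutoff -/

lemma one_sub_le_stdNormalCDF_of_bonferroniCutoff_lt {α x : ℝ} {n : ℕ} (hα : 0 < α) (hn : 0 < n)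
    (hx : bonferroniCutoff α n < x) : 1 - α / n ≤ stdNormalCDF x := by
  have hne : {y : ℝ | 1 - α / n ≤ stdNormalCDF y}.Nonempty := by
    have hlt : 1 - α / n < 1 := by
      have : 0 < α / n := by positivity
      linarith
    obtain ⟨y, hy⟩ := ((tendsto_cdf_atTop (gaussianReal 0 1)).eventually_const_lt hlt).exists
    exact ⟨y, hy.le⟩
  obtain ⟨y, hy, hyx⟩ := exists_lt_of_csInf_lt hne hx
  exact le_trans hy (monotone_cdf _ hyx.le)

lemma tendsto_bonferroniCutoff {α : ℝ} (hα : 0 < α) :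
    Tendsto (fun n : ℕ => bonferroniCutoff α n) atTop atTop := by
  refine tendsto_atTop.2 fun M => ?_
  have hlim : Tendsto (fun n : ℕ => 1 - α / n) atTop (𝓝 1) := by
    simpa using (tendsto_const_div_atTop_nhds_zero_nat α).const_sub 1
  -- `Φ` is below `1` at `max M 0`, so every point where `Φ ≥ 1 - α / n` eventually exceeds it.
  have hlt : stdNormalCDF (max M 0) < 1 := by
    have h := exp_le_one_sub_stdNormalCDF (le_max_right M 0)
    have : 0 < (√(2 * Real.pi))⁻¹ * Real.exp (-(max M 0 + 1) ^ 2 / 2) := by positivity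
    linarith
  filter_upwards [hlim.eventually_const_lt hlt, eventually_gt_atTop 0] with n hn hn0
  by_contra! hcut
  have hbdd := one_sub_le_stdNormalCDF_of_bonferroniCutoff_lt hα hn0 hcut
  exact absurd (hn.trans_le hbdd) (not_lt.2 (monotone_cdf _ (le_max_left M 0)))

/-- The number of hypotheses is at most of order `exp (c ^ 2 / 2 + O(c))` in the cutoff `c`. -/
lemma natCast_le_exp_bonferroniCutoff {α : ℝ} (hα : 0 < α) {n : ℕ} (hn : 0 < n)
    (hc : 0 ≤ bonferroniCutoff α n) :
    (n : ℝ) ≤ α * √(2 * Real.pi) * Real.exp ((bonferroniCutoff α n + 2) ^ 2 / 2) := by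
  set c := bonferroniCutoff α n with hcdef
  have hn' : (0 : ℝ) < n := by exact_mod_cast hn
  have hs : 0 < √(2 * Real.pi) := by positivity
  -- The shift to `c + 1` replaces right continuity of `Φ` at `c`.
  have h1 := one_sub_le_stdNormalCDF_of_bonferroniCutoff_lt hα hn (lt_add_one c)
  have h2 := exp_le_one_sub_stdNormalCDF (add_nonneg hc zero_le_one)
  have h3 : (√(2 * Real.pi))⁻¹ * Real.exp (-(c + 2) ^ 2 / 2) ≤ α / n := by
    rw [add_assoc, one_add_one_eq_two] at h2
    linarith
  rw [neg_div, Real.exp_neg, ← mul_inv, inv_le_comm₀ (by positivity) (by positivity), inv_div,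
    div_le_iff₀ hα] at h3
  linarith

/-! ### Asymptotics -/

/-- A Gaussian tail with variance `1 / β < 1` beats the growth in
`natCast_le_exp_bonferroniCutoff`. -/
lemma tendsto_exp_sq_mul_exp_neg_sq {β : ℝ} (hβ : 1 < β) :
    Tendsto (fun c : ℝ => Real.exp ((c + 2) ^ 2 / 2) * Real.exp (-(β * c ^ 2 / 2))) atTop
      (𝓝 0) := by
  simp_rw [← Real.exp_add]
  refine Real.tendsto_exp_atBot.comp ?_
  have hlin : Tendsto (fun c : ℝ => -((β - 1) / 2) * c + 2) atTop atBot :=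
    tendsto_atBot_add_const_right _ _ (tendsto_id.const_mul_atTop_of_neg (by linarith))
  refine (tendsto_atBot_add_const_right _ 2 (tendsto_id.atTop_mul_atBot₀ hlin)).congr fun c => ?_
  simp only [id]
  ring

lemma tendsto_exp_neg_mul_sq {b : ℝ} (hb : 0 < b) :
    Tendsto (fun c : ℝ => Real.exp (-(b * c ^ 2))) atTop (𝓝 0) :=
  Real.tendsto_exp_neg_atTop_nhds_zero.comp
    ((tendsto_pow_atTop two_ne_zero).const_mul_atTop hb)

/-! ### Correlations bounded below -/

lemma corrMatrix_diag (ρ : ℕ → ℕ → ℝ) (n : ℕ) (i : Fin n) : corrMatrix ρ n i i = 1 := by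
  simp [corrMatrix]

lemma abs_le_one_of_posSemidef_corrMatrix {ρ : ℕ → ℕ → ℝ}
    (hρ : ∀ n : ℕ, (corrMatrix ρ n).PosSemidef) {i j : ℕ} (hij : i ≠ j) : |ρ i j| ≤ 1 := by
  have h := (hρ (max i j + 1)).abs_apply_le_one (corrMatrix_diag ρ _)
    ⟨i, by omega⟩ ⟨j, by omega⟩
  simpa [corrMatrix, hij] using h

/-- The lower limit is a supremum of real numbers, which is meaningful because the correlations
are at least `-1`. -/
lemma exists_forall_le_of_lt_liminf_offDiagAtTop {ρ : ℕ → ℕ → ℝ}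
    (hρ : ∀ n : ℕ, (corrMatrix ρ n).PosSemidef) {r : ℝ}
    (hr : r < liminf (fun p : ℕ × ℕ => ρ p.1 p.2) offDiagAtTop) :
    ∃ N : ℕ, ∀ i j, N ≤ i → N ≤ j → i ≠ j → r ≤ ρ i j := by
  have hbdd : offDiagAtTop.IsBoundedUnder (· ≥ ·) (fun p : ℕ × ℕ => ρ p.1 p.2) := by
    refine isBoundedUnder_of_eventually_ge (a := -1) ?_
    rw [offDiagAtTop, eventually_inf_principal]
    exact Eventually.of_forall fun p hp => (abs_le.1 (abs_le_one_of_posSemidef_corrMatrix hρ hp)).1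
  have h := eventually_lt_of_lt_liminf hr hbdd
  rw [offDiagAtTop, eventually_inf_principal, eventually_atTop] at h
  obtain ⟨⟨a, b⟩, hab⟩ := h
  exact ⟨max a b, fun i j hi hj hij =>
    (hab (i, j) ⟨(le_max_left a b).trans hi, (le_max_right a b).trans hj⟩ hij).le⟩

/-- The first `N` coordinates are handled by a union bound, the others by their average, which is
cut at `K = r * c / 2`: with this choice the exponent `(1 - r ^ 2 / 2) ^ 2 / (1 - r ^ 2)` is still
greater than `1`. -/
lemma bonferroniFWER_le {ρ : ℕ → ℕ → ℝ} {n N : ℕ} {r α : ℝ}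
    (hS : (corrMatrix ρ n).PosSemidef) (hr0 : 0 < r) (hr1 : r < 1)
    (hN : ∀ i j, N ≤ i → N ≤ j → i ≠ j → r ≤ ρ i j) (hc : 0 ≤ bonferroniCutoff α n) :
    bonferroniFWER n α (corrMatrix ρ n) ≤
      N * Real.exp (-(1 / 2 * bonferroniCutoff α n ^ 2)) +
        (Real.exp (-(r ^ 2 / 8 * bonferroniCutoff α n ^ 2)) +
          n * Real.exp (-((1 - r ^ 2 / 2) ^ 2 / (1 - r ^ 2) * bonferroniCutoff α n ^ 2 / 2))) := by
  unfold bonferroniFWER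
  set c := bonferroniCutoff α n
  set S := corrMatrix ρ n with hSdef
  set μ := multivariateGaussian 0 S
  have hdiag : ∀ i, S i i = 1 := corrMatrix_diag ρ n
  let A : Finset (Fin n) := {i | (i : ℕ) < N}
  let T : Finset (Fin n) := {i | N ≤ (i : ℕ)}
  have hA : (A.card : ℝ) ≤ N := by
    have : A.card ≤ (Finset.range N).card :=
      Finset.card_le_card_of_injOn (fun i => (i : ℕ)) (fun i hi => by simpa [A] using hi)
        Fin.val_injective.injOn
    rw [Finset.card_range] at this
    exact_mod_cast this
  have hTn : (T.card : ℝ) ≤ n := by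
    exact_mod_cast (Finset.card_le_univ T).trans_eq (Fintype.card_fin n)
  have hTr : ∀ i ∈ T, ∀ j ∈ T, r ≤ S i j := by
    intro i hi j hj
    by_cases hij : i = j
    · rw [hij, hdiag]
      exact hr1.le
    · simp only [hSdef, corrMatrix, Matrix.of_apply, if_neg hij]
      exact hN i j (by simpa [T] using hi) (by simpa [T] using hj) (Fin.val_ne_of_ne hij)
  have hsub : {x : EuclideanSpace ℝ (Fin n) | ∃ i, c < x i} ⊆
      (⋃ i ∈ A, {x | c < x i}) ∪ {x | ∃ i ∈ T, c < x i} := by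
    rintro x ⟨i, hi⟩
    rcases lt_or_ge (i : ℕ) N with h | h
    · exact Or.inl (Set.mem_iUnion₂.2 ⟨i, by simpa [A] using h, hi⟩)
    · exact Or.inr ⟨i, by simpa [T] using h, hi⟩
  have hfirst : μ.real (⋃ i ∈ A, {x | c < x i}) ≤ N * Real.exp (-(1 / 2 * c ^ 2)) := by
    calc μ.real (⋃ i ∈ A, {x | c < x i}) ≤ ∑ i ∈ A, μ.real {x | c < x i} :=
          measureReal_biUnion_finset_le _ _
      _ ≤ ∑ i ∈ A, Real.exp (-c ^ 2 / 2) := Finset.sum_le_sum fun i _ =>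
          multivariateGaussian_real_coord_gt_le hS i (hdiag i) hc
      _ = A.card * Real.exp (-(1 / 2 * c ^ 2)) := by
          rw [Finset.sum_const, nsmul_eq_mul]
          congr 2
          ring
      _ ≤ N * Real.exp (-(1 / 2 * c ^ 2)) := by gcongr
  have hr2 : 0 < 1 - r ^ 2 := by nlinarith
  have hlast := multivariateGaussian_real_exists_mem_gt_le hS hdiag T hr0.le hr1 hTr
    (K := r * c / 2) (c := c) (by positivity) (by nlinarith [mul_nonneg hr2.le hc])
  have hexp1 : -(r * c / 2) ^ 2 / 2 = -(r ^ 2 / 8 * c ^ 2) := by ring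
  have hexp2 : -(c - r * (r * c / 2)) ^ 2 / (2 * (1 - r ^ 2)) =
      -((1 - r ^ 2 / 2) ^ 2 / (1 - r ^ 2) * c ^ 2 / 2) := by
    field_simp
  rw [hexp1, hexp2] at hlast
  refine ((measureReal_mono hsub).trans (measureReal_union_le _ _)).trans
    (add_le_add hfirst (hlast.trans ?_))
  gcongr

theorem theorem3p3 (ρ : ℕ → ℕ → ℝ)
    (hρ : ∀ n : ℕ, (corrMatrix ρ n).PosSemidef)
    (δ : ℝ) (hδ : 0 < δ)
    (hlim : liminf (fun p : ℕ × ℕ => ρ p.1 p.2) offDiagAtTop = δ)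
    (α : ℝ) (hα : α ∈ Set.Ioo (0 : ℝ) 1) :
    Tendsto (fun n : ℕ => bonferroniFWER n α (corrMatrix ρ n)) atTop (𝓝 0) := by
  obtain ⟨r, hr0, hr⟩ : ∃ r, 0 < r ∧ r < min δ 1 := exists_between (lt_min hδ one_pos)
  have hr1 : r < 1 := hr.trans_le (min_le_right _ _)
  obtain ⟨N, hN⟩ := exists_forall_le_of_lt_liminf_offDiagAtTop hρ
    (hlim.symm ▸ hr.trans_le (min_le_left _ _))
  have hr2 : 0 < 1 - r ^ 2 := by nlinarith
  set β : ℝ := (1 - r ^ 2 / 2) ^ 2 / (1 - r ^ 2) with hβdef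
  have hβ : 1 < β := by
    rw [hβdef, one_lt_div hr2]
    nlinarith [pow_pos hr0 4]
  have hcut := tendsto_bonferroniCutoff hα.1
  have hbound : Tendsto (fun c : ℝ => N * Real.exp (-(1 / 2 * c ^ 2)) +
      (Real.exp (-(r ^ 2 / 8 * c ^ 2)) + α * √(2 * Real.pi) *
        (Real.exp ((c + 2) ^ 2 / 2) * Real.exp (-(β * c ^ 2 / 2))))) atTop (𝓝 0) := by
    simpa using ((tendsto_exp_neg_mul_sq (b := 1 / 2) (by norm_num)).const_mul (N : ℝ)).add
      ((tendsto_exp_neg_mul_sq (b := r ^ 2 / 8) (by positivity)).add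
        ((tendsto_exp_sq_mul_exp_neg_sq hβ).const_mul (α * √(2 * Real.pi))))
  refine squeeze_zero' (Eventually.of_forall fun n => measureReal_nonneg) ?_ (hbound.comp hcut)
  filter_upwards [hcut.eventually_ge_atTop 0, eventually_gt_atTop 0] with n hc hn
  refine (bonferroniFWER_le (hρ n) hr0 hr1 hN hc).trans ?_
  simp only [Function.comp_apply, ← mul_assoc]
  gcongr
  exact natCast_le_exp_bonferroniCutoff hα.1 hn hc
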